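/- Let $C$ and $V$ be finite-dimensional real Euclidean spaces, let $\mathbf 1\in C$ be a distinguished unit vector, and let $(\zeta,v)\mapsto\zeta v$, $C\times V\to V$, be a bilinear map with $\mathbf 1v=v$, $|\zeta v|=|\zeta||v|$ and $C(Cv)=Cv$ for all $\zeta\in C$, $v\in V$, where $Cv=\{\zeta v:\zeta\in C\}$ (the cases $V=0$ and $C=\mathbb R\mathbf 1$ are allowed). For $\zeta=a\mathbf 1+z$ with $a\in\mathbb R$, $z\perp\mathbf 1$, put $\bar\zeta=a\mathbf 1-z$, and $\zeta^{-1}=|\zeta|^{-2}\bar\zeta$ if $\zeta\ne0$. For a unit vector $u\in V$ let $\cdot_u$ be the product on $C$ with $(\zeta\cdot_u\eta)u=\zeta(\eta u)$. Fix an orthonormal $C$-basis $v_1,\dots,v_n$ of $V$, i.e. an orthonormal family such that $V$ is the orthogonal sum of $Cv_1,\dots,Cv_n$. Let $W=C\oplus V$ (Euclidean direct sum), $d=\dim_{\mathbb R}C$ and $m=\dim_CW=n+1$. On $W\setminus\{0\}$ let $(0,u)\sim(0,v)$ if $u\in Cv$, and, for $\zeta\neq0$, $(\eta,u)\sim(\zeta,v)$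 if $\eta\ne0$ and $\eta^{-1}u=\zeta^{-1}v$. For $w\ne0$ let $[w]$ be the class of $w$ and $Cw=[w]\cup\{0\}$, which is a real linear subspace of $W$. Let $W_\infty=(W\setminus\{0\})/\!\sim$ with the quotient topology, and let $CPW=W\sqcup W_\infty$, where the basic neighborhoods of $w\in W$ are its Euclidean neighborhoods in $W$, and those of $p\in W_\infty$ are the sets $N\cup\{w\in W\setminus\{0\}:[w]\in N,\ |w|>R\}$ with $N$ a neighborhood of $p$ in $W_\infty$ and $R>0$. The coordinate patches of $CPW$ are $\varphi_j(W)$, $0\le j\le n+1$, with parametrizations $\varphi_j:W\to CPW$ given by $$\varphi_0(\zeta,v)=\begin{cases}(\zeta^{-1},\zeta^{-1}v)&\zeta\ne0,\\ [\mathbf 1,v]&\zeta=0,\end{cases}$$ $$\varphi_j(\zeta,\eta v_j+v')=\begin{cases}(\eta^{-1}\cdot_{v_j}\zeta,\ \eta^{-1}v_j+\eta^{-1}v')&\eta\neq0,\\ [\mathbf 1,\zeta^{-1}(v_j+v')]&\eta=0,\ \zeta\ne0,\\ [0,v_j+v']&\eta=\zeta=0,\end{cases}\qquad v'\perp Cv_j,\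 1\le j\le n,$$ and $\varphi_{n+1}$ the inclusion of $W$. The Riemannian metric of $CPW$ is the one whose expression in each of these patches is the following metric on $W$: at $w\ne0$ the subspaces $Cw$ and $(Cw)^\perp$ are orthogonal, and $$\langle X,Y\rangle_{w+}=\frac{\langle X,Y\rangle}{(1+|w|^2)^2}\ \ (X,Y\in Cw),\qquad \langle X,Y\rangle_{w+}=\frac{\langle X,Y\rangle}{1+|w|^2}\ \ (X,Y\in (Cw)^\perp);$$ at $w=0$ it is the inner product of $W$. **Theorem 7.1.** There is exactly one Borel measure on $CPW$ (the Riemannian volume measure) that in each of the patches has, in the coordinates, the density $\sqrt{\det(\langle e_i,e_k\rangle_{w+})}$ with respect to Lebesgue measure on $W$, where $(e_i)$ is an orthonormal basis of $W$; and the volume of $CPW$, i.e. its total mass, is $$\operatorname{vol}(CPW)=\frac{\Gamma\big(\frac d2\big)}{\Gamma\big((m+1)\frac d2\big)}\,\pi^{m\frac d2}.$$ -/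

import Mathlib

open MeasureTheory Topology

noncomputable section

/-- A `C`-module structure on `V` satisfying the `J²`-condition. Here `C` and `V` are
finite-dimensional real Euclidean spaces, `one` is a distinguished unit vector of `C`, and the
bilinear map `act ζ v` is the action `J(ζ, v) = ζ v`. The last field is `C(Cv) = Cv`. -/
structure J2CModule (C V : Type*) [NormedAddCommGroup C] [InnerProductSpace ℝ C]
    [NormedAddCommGroup V] [InnerProductSpace ℝ V] where
  one : C
  norm_one : ‖one‖ = 1
  act : C →ₗ[ℝ] V →ₗ[ℝ] V
  one_act : ∀ v, act one v = v
  norm_act : ∀ ζ v, ‖act ζ v‖ = ‖ζ‖ * ‖v‖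
  act_act : ∀ v, Set.image2 (fun ζ u => act ζ u) Set.univ (Set.range fun η => act η v) =
    Set.range fun η => act η v

namespace J2CModule

variable {C V : Type*} [NormedAddCommGroup C] [InnerProductSpace ℝ C]
  [NormedAddCommGroup V] [InnerProductSpace ℝ V]

section Algebra

variable (M : J2CModule C V)

lemma one_ne_zero : M.one ≠ 0 := by
  intro h
  have := M.norm_one
  simp [h] at this

/-- The subspace `C v` of `V`. -/
def orbit (v : V) : Submodule ℝ V := LinearMap.range (M.act.flip v)

lemma mem_orbit {v x : V} : x ∈ M.orbit v ↔ ∃ ζ, M.act ζ v = x := by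
  simp [orbit]

lemma act_mem_orbit {v x : V} (ζ : C) (hx : x ∈ M.orbit v) : M.act ζ x ∈ M.orbit v := by
  obtain ⟨η, rfl⟩ := M.mem_orbit.1 hx
  have h : M.act ζ (M.act η v) ∈ Set.range fun η => M.act η v := by
    rw [← M.act_act v]
    exact ⟨ζ, Set.mem_univ _, _, ⟨η, rfl⟩, rfl⟩
  exact M.mem_orbit.2 h

/-- The conjugate `a 1 - z` of `ζ = a 1 + z`, with `a` real and `z` orthogonal to `1`. -/
def conj (ζ : C) : C := (2 * inner ℝ M.one ζ) • M.one - ζ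

/-- The inverse `ζ⁻¹ = |ζ|⁻² ζ̄` of a nonzero element of `C`. -/
def inv (ζ : C) : C := (‖ζ‖ ^ 2)⁻¹ • M.conj ζ

lemma inner_act_left (ζ : C) (u v : V) :
    inner ℝ (M.act ζ u) (M.act ζ v) = ‖ζ‖ ^ 2 * inner ℝ u v := by
  have h1 := M.norm_act ζ (u + v)
  have h2 := M.norm_act ζ u
  have h3 := M.norm_act ζ v
  have e1 := norm_add_sq_real (M.act ζ u) (M.act ζ v)
  have e2 := norm_add_sq_real u v
  rw [← map_add, h1, h2, h3] at e1
  rw [mul_pow, e2] at e1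
  linarith

lemma inner_act_act (ζ η : C) (u v : V) :
    inner ℝ (M.act ζ u) (M.act η v) + inner ℝ (M.act η u) (M.act ζ v) =
      2 * inner ℝ ζ η * inner ℝ u v := by
  have h1 := M.inner_act_left (ζ + η) u v
  have h2 := M.inner_act_left ζ u v
  have h3 := M.inner_act_left η u v
  simp only [map_add, LinearMap.add_apply, inner_add_left, inner_add_right,
    norm_add_sq_real] at h1
  linarith

lemma conj_act (ζ : C) (v : V) : M.act (M.conj ζ) (M.act ζ v) = (‖ζ‖ ^ 2) • v := by
  refine ext_inner_right ℝ fun u => ?_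
  have h1 := M.inner_act_act ζ M.one (M.act ζ v) u
  have h2 := M.inner_act_left ζ v u
  rw [M.one_act, M.one_act] at h1
  simp only [conj, map_sub, map_smul, LinearMap.sub_apply, LinearMap.smul_apply, M.one_act,
    inner_sub_left, inner_smul_left, conj_trivial]
  rw [real_inner_comm] at h1
  rw [real_inner_comm M.one ζ] at h1
  rw [real_inner_comm u (M.act ζ (M.act ζ v))]
  linarith

lemma conj_conj (ζ : C) : M.conj (M.conj ζ) = ζ := by
  have h : inner ℝ M.one M.one = (1 : ℝ) := by rw [real_inner_self_eq_norm_sq, M.norm_one]; norm_num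
  simp only [conj, inner_sub_right, inner_smul_right, h]
  module

lemma norm_conj (ζ : C) : ‖M.conj ζ‖ = ‖ζ‖ := by
  rw [← sq_eq_sq₀ (norm_nonneg _) (norm_nonneg _)]
  simp only [conj, norm_sub_sq_real, norm_smul, M.norm_one, inner_smul_left, mul_one,
    Real.norm_eq_abs, sq_abs, conj_trivial]
  ring

lemma inv_act_act {ζ : C} (hζ : ζ ≠ 0) (v : V) : M.act (M.inv ζ) (M.act ζ v) = v := by
  have : ‖ζ‖ ^ 2 ≠ 0 := pow_ne_zero _ (norm_ne_zero_iff.2 hζ)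
  simp [inv, conj_act, smul_smul, this]

lemma act_inv_act {ζ : C} (hζ : ζ ≠ 0) (v : V) : M.act ζ (M.act (M.inv ζ) v) = v := by
  have h : ‖ζ‖ ^ 2 ≠ 0 := pow_ne_zero _ (norm_ne_zero_iff.2 hζ)
  have h1 := M.conj_act (M.conj ζ) v
  rw [M.conj_conj, M.norm_conj] at h1
  simp [inv, h1, smul_smul, h]

end Algebra

section Lines

/-- The Euclidean direct sum `W = C ⊕ V`. -/
abbrev W (_M : J2CModule C V) : Type _ := WithLp 2 (C × V)

variable (M : J2CModule C V)

/-- The element `(ζ, v)` of `W`. -/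
abbrev pt (ζ : C) (v : V) : M.W := WithLp.toLp 2 (ζ, v)

lemma pt_one_ne_zero (v : V) : M.pt M.one v ≠ 0 := fun h =>
  M.one_ne_zero (congrArg WithLp.fst h)

/-- The relation on nonzero elements of `W`: `(0, u) ∼ (0, v)` if `u ∈ C v`; for `ζ ≠ 0`,
`(η, u) ∼ (ζ, v)` if `η ≠ 0` and `η⁻¹ u = ζ⁻¹ v`. -/
def Rel (x w : M.W) : Prop :=
  (x.fst = 0 ∧ w.fst = 0 ∧ x.snd ∈ M.orbit w.snd) ∨
  (w.fst ≠ 0 ∧ x.fst ≠ 0 ∧ M.act (M.inv x.fst) x.snd = M.act (M.inv w.fst) w.snd)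

lemma eq_zero_or_rel_iff_of_fst_eq_zero {w x : M.W} (hw : w.fst = 0) :
    (x = 0 ∨ M.Rel x w) ↔ x.fst = 0 ∧ x.snd ∈ M.orbit w.snd := by
  constructor
  · rintro (rfl | ⟨h, -, h'⟩ | ⟨h, -⟩)
    · exact ⟨rfl, Submodule.zero_mem _⟩
    · exact ⟨h, h'⟩
    · exact absurd hw h
  · rintro ⟨h, h'⟩
    exact Or.inr (Or.inl ⟨h, hw, h'⟩)

lemma eq_zero_or_rel_iff_of_fst_ne_zero {w x : M.W} (hw : w.fst ≠ 0) :
    (x = 0 ∨ M.Rel x w) ↔ x.snd = M.act x.fst (M.act (M.inv w.fst) w.snd) := by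
  constructor
  · rintro (rfl | ⟨-, h, -⟩ | ⟨-, h, h'⟩)
    · simp
    · exact absurd h hw
    · rw [← h', M.act_inv_act h]
  · intro h
    by_cases hx : x.fst = 0
    · left
      rw [hx] at h
      have h2 : x.snd = 0 := by simpa using h
      refine (WithLp.ofLp_injective 2) (Prod.ext hx h2)
    · exact Or.inr (Or.inr ⟨hw, hx, by rw [h, M.inv_act_act hx]⟩)

/-- The `C`-line `C w` through `0`: the equivalence class of `w ≠ 0` together with `0`.
(For `w = 0` this is `{0}`.) -/
def cLine (w : M.W) : Submodule ℝ M.W where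
  carrier := {x | x = 0 ∨ M.Rel x w}
  zero_mem' := Or.inl rfl
  add_mem' := by
    intro x y hx hy
    simp only [Set.mem_ofPred_eq] at hx hy ⊢
    by_cases hw : w.fst = 0
    · rw [M.eq_zero_or_rel_iff_of_fst_eq_zero hw] at *
      exact ⟨by simp [hx.1, hy.1], by simpa using Submodule.add_mem _ hx.2 hy.2⟩
    · rw [M.eq_zero_or_rel_iff_of_fst_ne_zero hw] at *
      simp [hx, hy]
  smul_mem' := by
    intro c x hx
    simp only [Set.mem_ofPred_eq] at hx ⊢
    by_cases hw : w.fst = 0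
    · rw [M.eq_zero_or_rel_iff_of_fst_eq_zero hw] at *
      exact ⟨by simp [hx.1], by simpa using Submodule.smul_mem _ c hx.2⟩
    · rw [M.eq_zero_or_rel_iff_of_fst_ne_zero hw] at *
      simp [hx]

/-- The equivalence relation `∼` on `W ∖ {0}`. -/
def lineSetoid : Setoid {w : M.W // w ≠ 0} where
  r x w := M.Rel x w
  iseqv := by
    refine ⟨fun x => ?_, ?_, ?_⟩
    · by_cases h : x.1.fst = 0
      · exact Or.inl ⟨h, h, M.mem_orbit.2 ⟨M.one, M.one_act _⟩⟩
      · exact Or.inr ⟨h, h, rfl⟩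
    · rintro ⟨x, hx⟩ ⟨w, hw⟩ (⟨h, h', h''⟩ | ⟨h, h', h''⟩)
      · refine Or.inl ⟨h', h, ?_⟩
        obtain ⟨ζ, hζ⟩ := M.mem_orbit.1 h''
        have : ζ ≠ 0 := by
          rintro rfl
          refine hx ((WithLp.ofLp_injective 2) (Prod.ext h ?_))
          simpa using hζ.symm
        exact M.mem_orbit.2 ⟨M.inv ζ, by rw [← hζ, M.inv_act_act this]⟩
      · exact Or.inr ⟨h', h, h''.symm⟩
    · rintro x y z (⟨h, h', h''⟩ | ⟨h, h', h''⟩) (⟨k, k', k''⟩ | ⟨k, k', k''⟩)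
      · refine Or.inl ⟨h, k', ?_⟩
        obtain ⟨ζ, hζ⟩ := M.mem_orbit.1 h''
        rw [← hζ]
        exact M.act_mem_orbit ζ k''
      · exact absurd h' k'
      · exact absurd k h
      · exact Or.inr ⟨k, h', h''.trans k''⟩

/-- The space `W_∞ = (W ∖ {0}) / ∼` of points at infinity. -/
def Winf : Type _ := Quotient M.lineSetoid

/-- The quotient topology on `W_∞`. -/
instance : TopologicalSpace M.Winf :=
  inferInstanceAs (TopologicalSpace (Quotient M.lineSetoid))

/-- The quotient map `π : W ∖ {0} → W_∞`, `w ↦ [w]`. -/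
def toWinf (w : M.W) (hw : w ≠ 0) : M.Winf := Quotient.mk M.lineSetoid ⟨w, hw⟩

/-- The space `CPW = W ∪ W_∞` (disjoint union of sets). -/
inductive CPW : Type _
  | fin (w : M.W) : CPW
  | inf (p : M.Winf) : CPW

/-- The set `N ∪ {w ∈ π⁻¹(N) : |w| > R}`, for `N ⊆ W_∞`. -/
def infNhd (N : Set M.Winf) (R : ℝ) : Set M.CPW :=
  CPW.inf '' N ∪ CPW.fin '' {w | ∃ hw : w ≠ 0, M.toWinf w hw ∈ N ∧ R < ‖w‖}

/-- The topology of `CPW`: basic neighborhoods of `w ∈ W` are the Euclidean ones, basic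
neighborhoods of `p ∈ W_∞` are the sets `infNhd N R` with `N` a neighborhood of `p` in `W_∞`
and `R > 0`. A set is open if it contains a basic neighborhood of each of its points. -/
instance : TopologicalSpace M.CPW where
  IsOpen s := (∀ w, CPW.fin w ∈ s → ∃ N ∈ 𝓝 w, CPW.fin '' N ⊆ s) ∧
    ∀ p, CPW.inf p ∈ s → ∃ N ∈ 𝓝 p, ∃ R > 0, M.infNhd N R ⊆ s
  isOpen_univ := ⟨fun _ _ => ⟨Set.univ, Filter.univ_mem, Set.subset_univ _⟩,
    fun _ _ => ⟨Set.univ, Filter.univ_mem, 1, one_pos, Set.subset_univ _⟩⟩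
  isOpen_inter := by
    rintro s t ⟨hs, hs'⟩ ⟨ht, ht'⟩
    refine ⟨fun w hw => ?_, fun p hp => ?_⟩
    · obtain ⟨N, hN, h⟩ := hs w hw.1
      obtain ⟨N', hN', h'⟩ := ht w hw.2
      refine ⟨N ∩ N', Filter.inter_mem hN hN', ?_⟩
      rintro _ ⟨x, hx, rfl⟩
      exact ⟨h ⟨x, hx.1, rfl⟩, h' ⟨x, hx.2, rfl⟩⟩
    · obtain ⟨N, hN, R, hR, h⟩ := hs' p hp.1
      obtain ⟨N', hN', R', hR', h'⟩ := ht' p hp.2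
      refine ⟨N ∩ N', Filter.inter_mem hN hN', max R R', lt_max_of_lt_left hR, ?_⟩
      rintro _ (⟨q, hq, rfl⟩ | ⟨w, ⟨h0, hq, hR⟩, rfl⟩)
      · exact ⟨h (Or.inl ⟨q, hq.1, rfl⟩), h' (Or.inl ⟨q, hq.2, rfl⟩)⟩
      · exact ⟨h (Or.inr ⟨w, ⟨h0, hq.1, (max_lt_iff.1 hR).1⟩, rfl⟩),
          h' (Or.inr ⟨w, ⟨h0, hq.2, (max_lt_iff.1 hR).2⟩, rfl⟩)⟩
  isOpen_sUnion := by
    intro S hS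
    refine ⟨fun w hw => ?_, fun p hp => ?_⟩
    · obtain ⟨s, hs, hw⟩ := hw
      obtain ⟨N, hN, h⟩ := (hS s hs).1 w hw
      exact ⟨N, hN, h.trans (Set.subset_sUnion_of_mem hs)⟩
    · obtain ⟨s, hs, hp⟩ := hp
      obtain ⟨N, hN, R, hR, h⟩ := (hS s hs).2 p hp
      exact ⟨N, hN, R, hR, h.trans (Set.subset_sUnion_of_mem hs)⟩

/-- `CPW` carries its Borel `σ`-algebra. -/
instance : MeasurableSpace M.CPW := borel M.CPW

instance : BorelSpace M.CPW := ⟨rfl⟩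

end Lines

section Charts

variable [FiniteDimensional ℝ C] [FiniteDimensional ℝ V] (M : J2CModule C V)

/-- An orthonormal `C`-basis of `V`: an orthonormal family such that `V` is the orthogonal sum
of the subspaces `C v_j`. -/
structure IsOrthonormalCBasis {n : ℕ} (v : Fin n → V) : Prop where
  orthonormal : Orthonormal ℝ v
  orthogonal : Pairwise fun i j => M.orbit (v i) ⟂ M.orbit (v j)
  iSup_eq_top : ⨆ j, M.orbit (v j) = ⊤

/-- For a unit vector `u ∈ V`, the element `η ∈ C` in the orthogonal decomposition
`x = η u + x'` with `x' ⟂ C u`. -/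
def coeff (u x : V) : C := LinearMap.adjoint (M.act.flip u) x

lemma coeff_act {u : V} (hu : ‖u‖ = 1) (η : C) : M.coeff u (M.act η u) = η := by
  refine ext_inner_right ℝ fun ζ => ?_
  rw [coeff, LinearMap.adjoint_inner_left]
  have h := M.inner_act_act η ζ u u
  rw [real_inner_comm (M.act η u) (M.act ζ u)] at h
  rw [real_inner_self_eq_norm_sq, hu, one_pow, mul_one] at h
  simp only [LinearMap.flip_apply]
  linarith

/-- The component `x'` of `x = η u + x'` orthogonal to `C u`, for a unit vector `u`. -/
def rest (u x : V) : V := x - M.act (M.coeff u x) u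

lemma rest_mem_orthogonal {u : V} (hu : ‖u‖ = 1) (x : V) : M.rest u x ∈ (M.orbit u)ᗮ := by
  rw [Submodule.mem_orthogonal']
  intro y hy
  obtain ⟨ζ, rfl⟩ := M.mem_orbit.1 hy
  have h1 : inner ℝ (M.coeff u (M.rest u x)) ζ = inner ℝ (M.rest u x) (M.act ζ u) := by
    rw [coeff, LinearMap.adjoint_inner_left]; rfl
  rw [← h1]
  have h2 : M.coeff u (M.rest u x) = M.coeff u x - M.coeff u (M.act (M.coeff u x) u) :=
    map_sub (LinearMap.adjoint (M.act.flip u)) _ _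
  rw [h2, M.coeff_act hu, sub_self, inner_zero_left]

/-- The product `ζ ·ᵤ η` on `C` determined by a unit vector `u ∈ V`. -/
def mulAt (u : V) (ζ η : C) : C := M.coeff u (M.act ζ (M.act η u))

/-- The defining property of the product: `(ζ ·ᵤ η) u = ζ (η u)`. -/
lemma mulAt_act {u : V} (hu : ‖u‖ = 1) (ζ η : C) :
    M.act (M.mulAt u ζ η) u = M.act ζ (M.act η u) := by
  obtain ⟨ξ, hξ⟩ := M.mem_orbit.1 (M.act_mem_orbit ζ (M.mem_orbit.2 ⟨η, rfl⟩ : _ ∈ M.orbit u))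
  rw [mulAt, ← hξ, M.coeff_act hu]

lemma pt_zero_add_rest_ne_zero {u : V} (hu : ‖u‖ = 1) (x : V) :
    M.pt 0 (u + M.rest u x) ≠ 0 := by
  intro h
  have h1 : u + M.rest u x = 0 := congrArg WithLp.snd h
  have h2 := (Submodule.mem_orthogonal' _ _).1 (M.rest_mem_orthogonal hu x) u
    (M.mem_orbit.2 ⟨M.one, M.one_act u⟩)
  have h3 : inner ℝ (u + M.rest u x) u = (1 : ℝ) := by
    rw [inner_add_left, h2, real_inner_self_eq_norm_sq, hu]; norm_num
  rw [h1, inner_zero_left] at h3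
  exact zero_ne_one h3

open Classical in
/-- The map `φ₀` on `W`: `φ₀(ζ, v) = (ζ⁻¹, ζ⁻¹ v)` if `ζ ≠ 0`, and `φ₀(0, v) = [1, v]`. -/
def phiZero (w : M.W) : M.CPW :=
  if w.fst ≠ 0 then CPW.fin (M.pt (M.inv w.fst) (M.act (M.inv w.fst) w.snd))
  else CPW.inf (M.toWinf (M.pt M.one w.snd) (M.pt_one_ne_zero _))

open Classical in
/-- The map `φ_j` on `W` attached to a unit vector `u = v_j` of `V`. For `x' ⟂ C u`,
`φ_j(ζ, η u + x') = (η⁻¹ ·ᵤ ζ, η⁻¹ u + η⁻¹ x')` if `η ≠ 0`; and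
`φ_j(ζ, x') = [1, ζ⁻¹ (u + x')]` if `ζ ≠ 0`, `φ_j(0, x') = [0, u + x']`. -/
def phiUnit (u : V) (hu : ‖u‖ = 1) (w : M.W) : M.CPW :=
  let ζ := w.fst
  let η := M.coeff u w.snd
  let x' := M.rest u w.snd
  if η ≠ 0 then
    CPW.fin (M.pt (M.mulAt u (M.inv η) ζ) (M.act (M.inv η) u + M.act (M.inv η) x'))
  else if ζ ≠ 0 then
    CPW.inf (M.toWinf (M.pt M.one (M.act (M.inv ζ) (u + x'))) (M.pt_one_ne_zero _))
  else CPW.inf (M.toWinf (M.pt 0 (u + x')) (M.pt_zero_add_rest_ne_zero hu _))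

/-- Indices of the coordinate patches: `0`, then `1, …, n`, then `n + 1`. -/
inductive ChartIndex (n : ℕ) : Type
  | zero : ChartIndex n
  | basis (j : Fin n) : ChartIndex n
  | last : ChartIndex n

/-- The parametrizations `φ_j : W → CPW` of the coordinate patches `φ_j(W)`, `0 ≤ j ≤ n + 1`,
attached to an orthonormal `C`-basis of `V`; the last one is the inclusion of `W`. -/
def chart {n : ℕ} {v : Fin n → V} (hv : M.IsOrthonormalCBasis v) : ChartIndex n → M.W → M.CPW
  | .zero => M.phiZero
  | .basis j => M.phiUnit (v j) (hv.orthonormal.1 j)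
  | .last => CPW.fin

open Classical in
/-- The metric on `W`: at `w ≠ 0`, `C w` and its orthogonal complement are orthogonal, and the
metric is `⟨X, Y⟩ / (1 + |w|²)²` on `C w` and `⟨X, Y⟩ / (1 + |w|²)` on `(C w)ᗮ`; at `0` it is
the inner product of `W`. -/
def metric (w X Y : M.W) : ℝ :=
  if w = 0 then inner ℝ X Y
  else
    inner ℝ ((M.cLine w).starProjection X) ((M.cLine w).starProjection Y) / (1 + ‖w‖ ^ 2) ^ 2 +
    inner ℝ ((M.cLine w)ᗮ.starProjection X) ((M.cLine w)ᗮ.starProjection Y) / (1 + ‖w‖ ^ 2)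

end Charts

end J2CModule

/-- The density `√det(g(e_i, e_j))` of a metric `g` on a Euclidean space `E`, at the point `x`,
with respect to Lebesgue measure; `e` is an orthonormal basis of `E`. -/
def metricDensity {E : Type*} [NormedAddCommGroup E] [InnerProductSpace ℝ E]
    [FiniteDimensional ℝ E] (g : E → E → E → ℝ) (x : E) : ℝ :=
  √(Matrix.det (Matrix.of fun i j =>
    g x (stdOrthonormalBasis ℝ E i) (stdOrthonormalBasis ℝ E j)))

/-- `μ` is the Riemannian volume measure of a space `X` that is covered by the coordinate patches
`κ i (E)`, with parametrizations `κ i : E → X`, where `g i` is the expression of the metric in the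
`i`-th patch: in every patch `μ` has the density `√det g` in the coordinates. -/
def IsRiemannianVolume {E X ι : Type*} [NormedAddCommGroup E] [InnerProductSpace ℝ E]
    [FiniteDimensional ℝ E] [MeasurableSpace E] [BorelSpace E] [MeasurableSpace X]
    (κ : ι → E → X) (g : ι → E → E → E → ℝ) (μ : Measure X) : Prop :=
  ∀ i, ∀ A : Set X, MeasurableSet A → A ⊆ Set.range (κ i) →
    μ A = ∫⁻ x in κ i ⁻¹' A, ENNReal.ofReal (metricDensity (g i) x)

/-- `μ` is the Riemannian volume measure of `CPW`. The Riemannian metric of `CPW` is defined by requiring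
every `φ_j` to be an isometry, so that it has the same expression `M.metric` in every patch. -/
def J2CModule.IsVolume {C V : Type*} [NormedAddCommGroup C] [InnerProductSpace ℝ C]
    [NormedAddCommGroup V] [InnerProductSpace ℝ V] [FiniteDimensional ℝ C]
    [FiniteDimensional ℝ V] [MeasurableSpace C] [BorelSpace C] [MeasurableSpace V] [BorelSpace V]
    (M : J2CModule C V) {n : ℕ} {v : Fin n → V} (hv : M.IsOrthonormalCBasis v)
    (μ : Measure M.CPW) : Prop :=
  IsRiemannianVolume (M.chart hv) (fun _ => M.metric) μ

end

/-! In every patch the volume has the same density. At `w`, with `r = 1 + |w|²`, the metric has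
eigenvalue `r⁻²` on the `d`-dimensional space `Cw` and `r⁻¹` on its complement, so `√det` is `r ^
(-(d + dim W) / 2)` (`metricDensity_metric`). Almost everywhere, each `φ_j` is the inclusion of `W`
composed with a map that, after an isometry `W ≅ C ⊕ E`, reads `(η, e) ↦ (η⁻¹, η⁻¹e)`. This map
preserves the weighted measure: its Jacobian, `|η|^(-2d)` from `C` times `|η|^(-dim E)` from `E`, is
exactly what the weight compensates (`lintegral_comp_transition`). Hence the measure pushed forward
from `W` satisfies the condition in all patches. Conversely, `W_∞` is a finite union of relatively
open pieces, each inside one patch and null there. So a volume measure lives on `W`, where the last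
patch determines it (`IsVolume.eq_map`). The total mass is the integral of `(1 + |x|²)^(-s)` over
`W` with `s = (m + 1)d/2`, a Gamma quotient (`lintegral_one_add_norm_sq_rpow_neg`). -/

noncomputable section

/-! ### Euclidean integrals and a determinant -/

lemma lintegral_ofReal_exp_neg_mul_sq_norm {E : Type*} [NormedAddCommGroup E]
    [InnerProductSpace ℝ E] [FiniteDimensional ℝ E] [MeasurableSpace E] [BorelSpace E]
    {b : ℝ} (hb : 0 < b) :
    ∫⁻ x : E, ENNReal.ofReal (Real.exp (-b * ‖x‖ ^ 2)) =
      ENNReal.ofReal ((Real.pi / b) ^ ((Module.finrank ℝ E : ℝ) / 2)) := by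
  have h := GaussianFourier.integral_rexp_neg_mul_sq_norm (V := E) hb
  rw [← h, ofReal_integral_eq_lintegral_ofReal]
  -- The Bochner integral of a nonintegrable function is `0`, so the positive closed form already
  -- gives integrability.
  · refine Integrable.of_integral_ne_zero ?_
    rw [h]
    positivity
  · exact Filter.Eventually.of_forall fun x => (Real.exp_pos _).le

lemma lintegral_ofReal_rpow_mul_exp_neg_mul {a r : ℝ} (ha : 0 < a) (hr : 0 < r) :
    ∫⁻ t in Set.Ioi (0 : ℝ), ENNReal.ofReal (t ^ (a - 1) * Real.exp (-(r * t))) =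
      ENNReal.ofReal ((1 / r) ^ a * Real.Gamma a) := by
  have h := Real.integral_rpow_mul_exp_neg_mul_Ioi ha hr
  rw [← h, ofReal_integral_eq_lintegral_ofReal]
  · refine Integrable.of_integral_ne_zero ?_
    rw [h]
    have := Real.Gamma_pos_of_pos ha
    positivity
  · refine (ae_restrict_iff' measurableSet_Ioi).2 (Filter.Eventually.of_forall fun t ht => ?_)
    have : (0 : ℝ) < t := ht
    simp only [Pi.zero_apply]
    positivity

/-- The integral of the Japanese bracket `(1 + |x|²)^(-s)`. -/
lemma lintegral_one_add_norm_sq_rpow_neg (E : Type*) [NormedAddCommGroup E]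
    [InnerProductSpace ℝ E] [FiniteDimensional ℝ E] [MeasurableSpace E] [BorelSpace E]
    {s : ℝ} (hs : (Module.finrank ℝ E : ℝ) / 2 < s) :
    ∫⁻ x : E, ENNReal.ofReal ((1 + ‖x‖ ^ 2) ^ (-s)) =
      ENNReal.ofReal (Real.Gamma (s - (Module.finrank ℝ E : ℝ) / 2) / Real.Gamma s *
        Real.pi ^ ((Module.finrank ℝ E : ℝ) / 2)) := by
  set c := (Module.finrank ℝ E : ℝ) / 2 with hc
  have hc0 : 0 ≤ c := by positivity
  have hs0 : 0 < s := hc0.trans_lt hs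
  have hG := Real.Gamma_pos_of_pos hs0
  -- `Γ(s) (1 + |x|²)^(-s)` is the integral of `t^(s-1) exp(-(1 + |x|²)t)` over `t > 0`. By Tonelli
  -- the `x`-integral is a Gaussian, contributing `(π/t)^c`. The Gamma integral that remains
  -- converges because `s > c`.
  have key : ∫⁻ x : E, ENNReal.ofReal ((1 + ‖x‖ ^ 2) ^ (-s)) * ENNReal.ofReal (Real.Gamma s) =
      ENNReal.ofReal (Real.pi ^ c * Real.Gamma (s - c)) := by
    calc ∫⁻ x : E, ENNReal.ofReal ((1 + ‖x‖ ^ 2) ^ (-s)) * ENNReal.ofReal (Real.Gamma s)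
        = ∫⁻ x : E, ∫⁻ t in Set.Ioi (0 : ℝ),
            ENNReal.ofReal (t ^ (s - 1) * Real.exp (-((1 + ‖x‖ ^ 2) * t))) := by
          refine lintegral_congr fun x => ?_
          have hx : 0 < 1 + ‖x‖ ^ 2 := by positivity
          rw [lintegral_ofReal_rpow_mul_exp_neg_mul hs0 hx, ← ENNReal.ofReal_mul (by positivity),
            one_div, Real.inv_rpow hx.le, Real.rpow_neg hx.le]
      _ = ∫⁻ t in Set.Ioi (0 : ℝ), ∫⁻ x : E,
            ENNReal.ofReal (t ^ (s - 1) * Real.exp (-((1 + ‖x‖ ^ 2) * t))) := by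
          refine lintegral_lintegral_swap ?_
          refine Measurable.aemeasurable ?_
          unfold Function.uncurry
          fun_prop
      _ = ∫⁻ t in Set.Ioi (0 : ℝ),
            ENNReal.ofReal (Real.pi ^ c) *
              ENNReal.ofReal (t ^ (s - c - 1) * Real.exp (-(1 * t))) := by
          refine setLIntegral_congr_fun measurableSet_Ioi fun t ht => ?_
          have ht : (0 : ℝ) < t := ht
          have e1 : ∀ x : E, ENNReal.ofReal (t ^ (s - 1) * Real.exp (-((1 + ‖x‖ ^ 2) * t))) =
              ENNReal.ofReal (t ^ (s - 1) * Real.exp (-t)) *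
                ENNReal.ofReal (Real.exp (-t * ‖x‖ ^ 2)) := fun x => by
            rw [← ENNReal.ofReal_mul (by positivity), mul_assoc, ← Real.exp_add]
            ring_nf
          simp only [e1]
          rw [lintegral_const_mul _ (by fun_prop), lintegral_ofReal_exp_neg_mul_sq_norm ht,
            ← ENNReal.ofReal_mul (by positivity), ← ENNReal.ofReal_mul (by positivity), ← hc]
          congr 1
          rw [Real.div_rpow Real.pi_pos.le ht.le, sub_right_comm, Real.rpow_sub ht (s - 1) c,
            one_mul]
          ring
      _ = ENNReal.ofReal (Real.pi ^ c * Real.Gamma (s - c)) := by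
          rw [lintegral_const_mul _ (by fun_prop),
            lintegral_ofReal_rpow_mul_exp_neg_mul (by linarith) one_pos,
            ← ENNReal.ofReal_mul (by positivity)]
          simp
  rw [lintegral_mul_const _ (by fun_prop)] at key
  have h0 : ENNReal.ofReal (Real.Gamma s) ≠ 0 := by simpa using hG
  rw [(ENNReal.eq_div_iff h0 ENNReal.ofReal_ne_top).2 ((mul_comm _ _).trans key),
    ← ENNReal.ofReal_div_of_pos hG]
  congr 1
  ring

/-- The determinant of the operator which is multiplication by `a` on `K` and by `b` on `Kᗮ`. -/
lemma det_smul_starProjection_add {E : Type*} [NormedAddCommGroup E] [InnerProductSpace ℝ E]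
    [FiniteDimensional ℝ E] (K : Submodule ℝ E) (a b : ℝ) :
    LinearMap.det (a • (K.starProjection : E →ₗ[ℝ] E) + b • (Kᗮ.starProjection : E →ₗ[ℝ] E)) =
      a ^ Module.finrank ℝ K * b ^ Module.finrank ℝ Kᗮ := by
  let e := K.prodEquivOfIsCompl _ K.isCompl_orthogonal
  -- The operator is block diagonal with respect to `K ⊕ Kᗮ`.
  have h : (a • (K.starProjection : E →ₗ[ℝ] E) + b • (Kᗮ.starProjection : E →ₗ[ℝ] E)) =
      e.toLinearMap ∘ₗ (LinearMap.prodMap (a • LinearMap.id) (b • LinearMap.id)) ∘ₗ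
        e.symm.toLinearMap := by
    rw [← LinearMap.comp_assoc, LinearEquiv.eq_comp_toLinearMap_symm]
    ext x
    · have h1 : K.starProjection (x : E) = x := Submodule.starProjection_eq_self_iff.2 x.2
      have h2 : Kᗮ.starProjection (x : E) = 0 := by
        rw [Submodule.starProjection_orthogonal_val, h1, sub_self]
      simp [e, h1, h2]
    · have h2 : Kᗮ.starProjection (x : E) = x := Submodule.starProjection_eq_self_iff.2 x.2
      have h1 : K.starProjection (x : E) = 0 := by
        have := Submodule.starProjection_orthogonal_val (K := K) (x : E)
        rw [h2] at this
        exact sub_eq_self.1 this.symm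
      simp [e, h1, h2]
  rw [h, LinearMap.det_conj, LinearMap.det_prodMap, LinearMap.det_smul, LinearMap.det_smul]
  simp

/-! ### Dimension of `C`-lines and the density in a patch -/

namespace J2CModule

variable {C V : Type*} [NormedAddCommGroup C] [InnerProductSpace ℝ C]
  [NormedAddCommGroup V] [InnerProductSpace ℝ V] (M : J2CModule C V)

lemma act_ne_zero {ζ : C} {v : V} (hζ : ζ ≠ 0) (hv : v ≠ 0) : M.act ζ v ≠ 0 := by
  rw [← norm_ne_zero_iff, M.norm_act]
  exact mul_ne_zero (norm_ne_zero_iff.2 hζ) (norm_ne_zero_iff.2 hv)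

lemma norm_inv (ζ : C) : ‖M.inv ζ‖ = ‖ζ‖⁻¹ := by
  rw [inv, norm_smul, M.norm_conj, _root_.norm_inv, norm_pow, norm_norm, pow_two]
  by_cases h : ‖ζ‖ = 0
  · simp [h]
  · field_simp

lemma inv_ne_zero {ζ : C} (hζ : ζ ≠ 0) : M.inv ζ ≠ 0 := by
  rw [← norm_ne_zero_iff, M.norm_inv]
  exact _root_.inv_ne_zero (norm_ne_zero_iff.2 hζ)

lemma inv_inv {ζ : C} (hζ : ζ ≠ 0) : M.inv (M.inv ζ) = ζ := by
  have h : ‖ζ‖ ≠ 0 := norm_ne_zero_iff.2 hζ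
  have hc : ∀ (r : ℝ) (η : C), M.conj (r • η) = r • M.conj η := fun r η => by
    simp only [conj, inner_smul_right]
    module
  rw [inv, M.norm_inv, inv, hc, M.conj_conj, smul_smul, inv_pow, _root_.inv_inv,
    mul_inv_cancel₀ (pow_ne_zero _ h), one_smul]

lemma finrank_orbit {v : V} (hv : v ≠ 0) : Module.finrank ℝ (M.orbit v) = Module.finrank ℝ C := by
  refine LinearMap.finrank_range_of_inj ((injective_iff_map_eq_zero _).2 fun ζ h => ?_)
  by_contra hζ
  exact M.act_ne_zero hζ hv h

/-- `Cw` is the image of `C` under an injective linear map: `ζ ↦ (0, ζ w₂)` if `w₁ = 0`, and `ζ ↦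
(ζ, ζ(w₁⁻¹ w₂))` otherwise. -/
lemma finrank_cLine {w : M.W} (hw : w ≠ 0) :
    Module.finrank ℝ (M.cLine w) = Module.finrank ℝ C := by
  let e := (WithLp.linearEquiv 2 ℝ (C × V)).symm
  by_cases h : w.fst = 0
  · let f : C →ₗ[ℝ] M.W := e.toLinearMap ∘ₗ LinearMap.inr ℝ C V ∘ₗ M.act.flip w.snd
    have hw2 : w.snd ≠ 0 := fun h' => hw (WithLp.ofLp_injective 2 (Prod.ext h h'))
    have hf : Function.Injective f := by
      refine (injective_iff_map_eq_zero _).2 fun ζ h => ?_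
      by_contra hζ
      exact M.act_ne_zero hζ hw2 (congrArg WithLp.snd h)
    have hr : M.cLine w = LinearMap.range f := by
      ext x
      refine (M.eq_zero_or_rel_iff_of_fst_eq_zero h).trans ?_
      rw [M.mem_orbit, LinearMap.mem_range]
      constructor
      · rintro ⟨h1, ζ, h2⟩
        exact ⟨ζ, WithLp.ofLp_injective 2 (Prod.ext h1.symm h2)⟩
      · rintro ⟨ζ, rfl⟩
        exact ⟨rfl, ζ, rfl⟩
    rw [hr, LinearMap.finrank_range_of_inj hf]
  · let f : C →ₗ[ℝ] M.W := e.toLinearMap ∘ₗ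
      LinearMap.prod LinearMap.id (M.act.flip (M.act (M.inv w.fst) w.snd))
    have hf : Function.Injective f := fun ζ η h => congrArg WithLp.fst h
    have hr : M.cLine w = LinearMap.range f := by
      ext x
      refine (M.eq_zero_or_rel_iff_of_fst_ne_zero h).trans ?_
      rw [LinearMap.mem_range]
      constructor
      · intro h
        exact ⟨x.fst, WithLp.ofLp_injective 2 (Prod.ext rfl h.symm)⟩
      · rintro ⟨ζ, rfl⟩
        rfl
    rw [hr, LinearMap.finrank_range_of_inj hf]

variable [FiniteDimensional ℝ C] [FiniteDimensional ℝ V]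

/-- The density of the Riemannian volume in each coordinate patch. -/
lemma metricDensity_metric (w : M.W) : metricDensity M.metric w =
    (1 + ‖w‖ ^ 2) ^ (-((Module.finrank ℝ C + Module.finrank ℝ M.W : ℝ) / 2)) := by
  let b := stdOrthonormalBasis ℝ M.W
  by_cases hw : w = 0
  · have : (Matrix.of fun i j => M.metric w (b i) (b j)) = 1 := by
      ext i j
      rw [Matrix.of_apply, metric, if_pos hw, Matrix.one_apply,
        orthonormal_iff_ite.1 b.orthonormal i j]
    rw [metricDensity, this]
    simp [hw]
  · set r := 1 + ‖w‖ ^ 2 with hr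
    have hr0 : 0 < r := by positivity
    let K := M.cLine w
    -- Orthogonal projections are self-adjoint and idempotent, so the Gram matrix is the matrix of
    -- an operator that is scalar on `K` and on `Kᗮ`.
    have : (Matrix.of fun i j => M.metric w (b i) (b j)) = LinearMap.toMatrix b.toBasis b.toBasis
        (((r ^ 2)⁻¹) • (K.starProjection : M.W →ₗ[ℝ] M.W) +
          r⁻¹ • (Kᗮ.starProjection : M.W →ₗ[ℝ] M.W)) := by
      ext i j
      have e : ∀ (L : Submodule ℝ M.W) (x y : M.W),
          inner ℝ (L.starProjection x) (L.starProjection y) = inner ℝ x (L.starProjection y) := by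
        intro L x y
        rw [Submodule.inner_starProjection_left_eq_right,
          Submodule.starProjection_eq_self_iff.2 (Submodule.starProjection_apply_mem L y)]
      simp only [metric, if_neg hw, Matrix.of_apply, LinearMap.toMatrix_apply, e]
      rw [OrthonormalBasis.coe_toBasis, OrthonormalBasis.coe_toBasis_repr_apply,
        OrthonormalBasis.repr_apply_apply]
      simp only [LinearMap.add_apply, LinearMap.smul_apply, inner_add_right, inner_smul_right]
      rw [← hr, div_eq_inv_mul, div_eq_inv_mul]
      rfl
    rw [metricDensity, this, LinearMap.det_toMatrix, det_smul_starProjection_add]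
    -- The exponent of `r⁻¹` in the determinant is `2d + (dim W - d) = d + dim W`; the square root
    -- halves it.
    have h1 := K.finrank_add_finrank_orthogonal
    rw [M.finrank_cLine hw] at h1 ⊢
    rw [← h1, inv_pow, inv_pow, ← pow_mul, ← mul_inv, ← pow_add, Real.sqrt_eq_rpow,
      Real.rpow_neg hr0.le, Real.inv_rpow (by positivity), ← Real.rpow_natCast,
      ← Real.rpow_mul hr0.le]
    congr 2
    push_cast
    ring

end J2CModule
end

/-! ### Changes of variables and invariance of the weighted measure -/

noncomputable section

/-- Change of variables for the inversion in the unit sphere. -/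
lemma lintegral_comp_inversion {E : Type*} [NormedAddCommGroup E]
    [InnerProductSpace ℝ E] [FiniteDimensional ℝ E] [MeasurableSpace E] [BorelSpace E]
    [Nontrivial E] (f : E → ENNReal) :
    ∫⁻ x : E, ENNReal.ofReal ((‖x‖ ^ (2 * Module.finrank ℝ E))⁻¹) *
      f (EuclideanGeometry.inversion 0 1 x) = ∫⁻ x, f x := by
  have hs : MeasurableSet ({0}ᶜ : Set E) := (measurableSet_singleton _).compl
  have himg : EuclideanGeometry.inversion 0 1 '' ({0}ᶜ : Set E) = {0}ᶜ := by
    refine Set.Subset.antisymm ?_ fun x hx => ?_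
    · rintro _ ⟨x, hx, rfl⟩
      simpa using hx
    · exact ⟨EuclideanGeometry.inversion 0 1 x, by simpa using hx,
        EuclideanGeometry.inversion_inversion 0 one_ne_zero x⟩
  -- The origin is null only because `E` is nontrivial.
  have hae : (({0}ᶜ : Set E)) =ᵐ[volume] Set.univ := by
    rw [ae_eq_univ, compl_compl]
    exact measure_singleton 0
  have h := lintegral_image_eq_lintegral_abs_det_fderiv_mul volume hs
    (fun x hx => (EuclideanGeometry.hasFDerivAt_inversion (R := 1) hx).hasFDerivWithinAt)
    (EuclideanGeometry.inversion_injective (0 : E) one_ne_zero).injOn f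
  rw [himg, setLIntegral_congr hae, setLIntegral_congr hae, setLIntegral_univ,
    setLIntegral_univ] at h
  rw [h]
  refine lintegral_congr fun x => ?_
  congr 2
  -- The derivative of the inversion at `x` is `|x|⁻²` times a reflection, whose determinant is
  -- `±1`.
  rw [ContinuousLinearMap.det, ContinuousLinearMap.toLinearMap_smul, LinearMap.det_smul, abs_mul]
  have h1 : |LinearMap.det (((ℝ ∙ (x - 0))ᗮ.reflection : E →L[ℝ] E) : E →ₗ[ℝ] E)| = 1 := by
    have := (ℝ ∙ (x - 0))ᗮ.det_reflection
    have h2 : |LinearMap.det ((ℝ ∙ (x - 0))ᗮ.reflection.toLinearEquiv : E →ₗ[ℝ] E)| = 1 := by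
      rw [this, abs_pow, abs_neg, abs_one, one_pow]
    exact h2
  rw [h1, mul_one, dist_zero_right, one_div, inv_pow, inv_pow, ← pow_mul, abs_inv, abs_pow,
    abs_norm]

/-- Change of variables for a linear conformal map. -/
lemma lintegral_comp_of_norm_eq {E : Type*} [NormedAddCommGroup E]
    [InnerProductSpace ℝ E] [FiniteDimensional ℝ E] [MeasurableSpace E] [BorelSpace E]
    {r : ℝ} (hr : 0 < r) (T : E →ₗ[ℝ] E) (hT : ∀ x, ‖T x‖ = r * ‖x‖) {f : E → ENNReal}
    (hf : Measurable f) :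
    ∫⁻ x, f (T x) = ENNReal.ofReal ((r ^ Module.finrank ℝ E)⁻¹) * ∫⁻ x, f x := by
  -- `T` is a linear isometry, bijective by finite dimension, followed by the dilation by `r`.
  let U : E →ₗᵢ[ℝ] E := ⟨r⁻¹ • T, fun x => by
    rw [LinearMap.smul_apply, norm_smul, hT, Real.norm_of_nonneg (by positivity),
      inv_mul_cancel_left₀ hr.ne']⟩
  let e : E ≃ₗᵢ[ℝ] E := U.toLinearIsometryEquiv rfl
  have he : ∀ x, T x = r • e x := fun x => by
    change T x = r • (r⁻¹ • T x)
    rw [smul_smul, mul_inv_cancel₀ hr.ne', one_smul]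
  simp only [he]
  have hfr : Measurable fun x => f (r • x) := hf.comp (measurable_const_smul r)
  rw [e.measurePreserving.lintegral_comp hfr,
    ← lintegral_map hf (measurable_const_smul r), Measure.map_addHaar_smul _ hr.ne',
    lintegral_smul_measure, abs_of_nonneg (by positivity), smul_eq_mul]

namespace J2CModule

variable {C V : Type*} [NormedAddCommGroup C] [InnerProductSpace ℝ C]
  [NormedAddCommGroup V] [InnerProductSpace ℝ V] (M : J2CModule C V)

lemma nontrivial (M : J2CModule C V) : Nontrivial C := ⟨M.one, 0, M.one_ne_zero⟩

lemma conj_eq_reflection (ζ : C) : M.conj ζ = (ℝ ∙ M.one).reflection ζ := by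
  rw [Submodule.reflection_singleton_apply, conj, M.norm_one]
  module

lemma inv_eq_conj_inversion (ζ : C) :
    M.inv ζ = M.conj (EuclideanGeometry.inversion 0 1 ζ) := by
  simp [conj_eq_reflection, inv, EuclideanGeometry.inversion]

lemma measurable_inv [FiniteDimensional ℝ C] [MeasurableSpace C] [BorelSpace C] :
    Measurable M.inv := by
  unfold inv conj
  fun_prop

variable [FiniteDimensional ℝ C] [MeasurableSpace C] [BorelSpace C]

/-- `ζ ↦ ζ⁻¹` is the inversion in the unit sphere followed by the reflection `conj`, so only the
Jacobian of the inversion appears. -/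
lemma lintegral_comp_inv {f : C → ENNReal} (hf : Measurable f) :
    ∫⁻ ζ, ENNReal.ofReal ((‖ζ‖ ^ (2 * Module.finrank ℝ C))⁻¹) * f (M.inv ζ) = ∫⁻ ζ, f ζ := by
  have := M.nontrivial
  have h := lintegral_comp_inversion (fun ζ => f (M.conj ζ))
  simp only [← inv_eq_conj_inversion] at h
  rw [h]
  simp only [conj_eq_reflection]
  exact ((ℝ ∙ M.one).reflection).measurePreserving.lintegral_comp hf

/-- The weight `(1 + |x|²)^(-(d + dim E)/2)`, where `d` is the real dimension of `C`. -/
def weight (C E : Type*) [NormedAddCommGroup C] [InnerProductSpace ℝ C] [NormedAddCommGroup E]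
    [InnerProductSpace ℝ E] (x : E) : ENNReal :=
  ENNReal.ofReal ((1 + ‖x‖ ^ 2) ^ (-((Module.finrank ℝ C + Module.finrank ℝ E : ℝ) / 2)))

omit [FiniteDimensional ℝ C] [MeasurableSpace C] [BorelSpace C] in
lemma measurable_weight {E : Type*} [NormedAddCommGroup E]
    [InnerProductSpace ℝ E] [MeasurableSpace E] [BorelSpace E] : Measurable (weight C E) := by
  unfold weight
  fun_prop

/-- The measure with density `weight` is invariant under `(η, e) ↦ (η⁻¹, η⁻¹ e)`, for a
norm-multiplicative action of `C` on `E`. -/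
lemma lintegral_comp_transition {E : Type*} [NormedAddCommGroup E]
    [InnerProductSpace ℝ E] [FiniteDimensional ℝ E] [MeasurableSpace E] [BorelSpace E]
    (L : C → E →ₗ[ℝ] E) (hLc : Continuous fun p : C × E => L p.1 p.2)
    (hL : ∀ ξ x, ‖L ξ x‖ = ‖ξ‖ * ‖x‖) {f : WithLp 2 (C × E) → ENNReal} (hf : Measurable f) :
    ∫⁻ p : WithLp 2 (C × E), f (WithLp.toLp 2 (M.inv p.fst, L (M.inv p.fst) p.snd)) *
        weight C (WithLp 2 (C × E)) p =
      ∫⁻ p : WithLp 2 (C × E), f p * weight C (WithLp 2 (C × E)) p := by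
  have := M.nontrivial
  set d := Module.finrank ℝ C with hd
  set k := Module.finrank ℝ E with hk
  let h : WithLp 2 (C × E) → ENNReal := fun p => f p * weight C (WithLp 2 (C × E)) p
  have hh : Measurable h := hf.mul measurable_weight
  have hto : Measurable (WithLp.toLp 2 : C × E → WithLp 2 (C × E)) :=
    (WithLp.volume_preserving_toLp C E).measurable
  have hinv := M.measurable_inv
  have hT : Measurable fun p : C × E => L (M.inv p.1) p.2 :=
    hLc.measurable.comp ((hinv.comp measurable_fst).prodMk measurable_snd)
  have hfin : Module.finrank ℝ (WithLp 2 (C × E)) = d + k := by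
    rw [(WithLp.linearEquiv 2 ℝ (C × E)).finrank_eq, Module.finrank_prod]
  -- From `1 + |η⁻¹|² + |η⁻¹x|² = |η|⁻² (1 + |η|² + |x|²)`. The factor `|η|^(-2d)` is the Jacobian
  -- of `η ↦ η⁻¹`, and `|η|^(-k)` that of `x ↦ η⁻¹x`. Only multiplicativity of norms is used, no
  -- composition law for `L`.
  have hw : ∀ (η : C) (x : E), η ≠ 0 → weight C (WithLp 2 (C × E)) (WithLp.toLp 2 (η, x)) =
      ENNReal.ofReal ((‖η‖ ^ (2 * d))⁻¹) * (ENNReal.ofReal ((‖η‖ ^ k)⁻¹) *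
        weight C (WithLp 2 (C × E)) (WithLp.toLp 2 (M.inv η, L (M.inv η) x))) := by
    intro η x hη
    have hn : 0 < ‖η‖ := norm_pos_iff.2 hη
    rw [weight, weight, hfin, WithLp.prod_norm_sq_eq_of_L2, WithLp.prod_norm_sq_eq_of_L2]
    simp only [WithLp.toLp_fst, WithLp.toLp_snd, hL, M.norm_inv]
    rw [← ENNReal.ofReal_mul (by positivity), ← ENNReal.ofReal_mul (by positivity)]
    congr 1
    have e1 : 1 + (‖η‖⁻¹ ^ 2 + (‖η‖⁻¹ * ‖x‖) ^ 2) =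
        (‖η‖ ^ 2)⁻¹ * (1 + (‖η‖ ^ 2 + ‖x‖ ^ 2)) := by
      field_simp
      ring
    have e2 : ((‖η‖ ^ 2)⁻¹) ^ (-(((d : ℝ) + ((d + k : ℕ) : ℝ)) / 2)) = ‖η‖ ^ (2 * d + k) := by
      rw [Real.rpow_neg (by positivity), Real.inv_rpow (by positivity), _root_.inv_inv,
        ← Real.rpow_natCast, ← Real.rpow_mul hn.le, ← Real.rpow_natCast]
      congr 1
      push_cast
      ring
    rw [e1, Real.mul_rpow (by positivity) (by positivity), e2, pow_add]
    field_simp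
  have h1 : ∀ g : WithLp 2 (C × E) → ENNReal, Measurable g →
      ∫⁻ p, g p = ∫⁻ η : C, ∫⁻ x : E, g (WithLp.toLp 2 (η, x)) := by
    intro g hg
    rw [← (WithLp.volume_preserving_toLp C E).lintegral_comp hg]
    exact lintegral_prod _ (hg.comp hto).aemeasurable
  have hTm : Measurable fun p : WithLp 2 (C × E) =>
      (WithLp.toLp 2 (M.inv p.fst, L (M.inv p.fst) p.snd) : WithLp 2 (C × E)) :=
    hto.comp (((hinv.comp measurable_fst).prodMk hT).comp
      (WithLp.volume_preserving_ofLp C E).measurable)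
  -- The fibre integral in terms of `ξ = η⁻¹`; the factor `|ξ|^k` cancels against the substitution
  -- `x ↦ L ξ x`.
  let G : C → ENNReal := fun ξ =>
    ∫⁻ x, ENNReal.ofReal (‖ξ‖ ^ k) * h (WithLp.toLp 2 (ξ, L ξ x))
  have hGm : Measurable G := by
    refine Measurable.lintegral_prod_right'
      (f := fun p : C × E => ENNReal.ofReal (‖p.1‖ ^ k) * h (WithLp.toLp 2 (p.1, L p.1 p.2))) ?_
    have : Measurable fun p : C × E => h (WithLp.toLp 2 (p.1, L p.1 p.2)) :=
      hh.comp (hto.comp (measurable_fst.prodMk hLc.measurable))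
    fun_prop
  have hne : ∀ᵐ η : C, η ≠ 0 := by
    rw [ae_iff]
    simp
  calc ∫⁻ p : WithLp 2 (C × E), f (WithLp.toLp 2 (M.inv p.fst, L (M.inv p.fst) p.snd)) *
        weight C (WithLp 2 (C × E)) p
      = ∫⁻ η : C, ∫⁻ x : E, f (WithLp.toLp 2 (M.inv η, L (M.inv η) x)) *
          weight C (WithLp 2 (C × E)) (WithLp.toLp 2 (η, x)) :=
        h1 _ ((hf.comp hTm).mul measurable_weight)
    _ = ∫⁻ η : C, ENNReal.ofReal ((‖η‖ ^ (2 * d))⁻¹) * G (M.inv η) := by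
        refine lintegral_congr_ae (hne.mono fun η hη => ?_)
        have hη : η ≠ 0 := hη
        change _ = ENNReal.ofReal ((‖η‖ ^ (2 * d))⁻¹) * ∫⁻ x, _
        rw [← lintegral_const_mul']
        · refine lintegral_congr fun x => ?_
          rw [hw η x hη, M.norm_inv, inv_pow]
          simp only [h]
          ring
        · exact ENNReal.ofReal_ne_top
    _ = ∫⁻ ξ : C, G ξ := M.lintegral_comp_inv hGm
    _ = ∫⁻ ξ : C, ∫⁻ x : E, h (WithLp.toLp 2 (ξ, x)) := by
        refine lintegral_congr_ae (hne.mono fun ξ hξ => ?_)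
        have hn : 0 < ‖ξ‖ := norm_pos_iff.2 hξ
        have hm : Measurable fun x => h (WithLp.toLp 2 (ξ, x)) :=
          hh.comp (hto.comp measurable_prodMk_left)
        change ∫⁻ x, _ = _
        rw [lintegral_const_mul' _ _ ENNReal.ofReal_ne_top,
          lintegral_comp_of_norm_eq hn (L ξ) (hL ξ) hm, ← mul_assoc,
          ← ENNReal.ofReal_mul (by positivity), mul_inv_cancel₀ (by positivity)]
        simp
    _ = ∫⁻ p, h p := (h1 _ hh).symm

end J2CModule
end

/-! ### Points at infinity: measurability and covering by patches -/

noncomputable section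

namespace J2CModule

variable {C V : Type*} [NormedAddCommGroup C] [InnerProductSpace ℝ C]
  [NormedAddCommGroup V] [InnerProductSpace ℝ V] (M : J2CModule C V)

section Topological

lemma continuous_fin : Continuous (CPW.fin : M.W → M.CPW) := by
  refine continuous_def.2 fun s hs => isOpen_iff_mem_nhds.2 fun w hw => ?_
  obtain ⟨N, hN, h⟩ := hs.1 w hw
  exact Filter.mem_of_superset hN fun x hx => h ⟨x, hx, rfl⟩

lemma isOpen_range_fin : IsOpen (Set.range (CPW.fin : M.W → M.CPW)) := by
  refine ⟨fun w _ => ⟨Set.univ, Filter.univ_mem, by simp⟩, ?_⟩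
  rintro p ⟨w, hw⟩
  cases hw

/-- The union with all of `W` is open, and `W` itself is open, so the image is a difference of open
sets. -/
lemma measurableSet_image_inf {N : Set M.Winf} (hN : IsOpen N) :
    MeasurableSet (CPW.inf '' N : Set M.CPW) := by
  have h : IsOpen (CPW.inf '' N ∪ Set.range CPW.fin : Set M.CPW) := by
    refine ⟨fun w _ => ⟨Set.univ, Filter.univ_mem, ?_⟩, ?_⟩
    · rintro _ ⟨x, -, rfl⟩
      exact Or.inr ⟨x, rfl⟩
    · rintro p (⟨q, hq, h⟩ | ⟨w, hw⟩)
      · cases h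
        refine ⟨N, hN.mem_nhds hq, 1, one_pos, Set.union_subset_union_right _ ?_⟩
        exact Set.image_subset_range _ _
      · cases hw
  convert h.measurableSet.diff M.isOpen_range_fin.measurableSet using 1
  rw [Set.union_sdiff_right, sdiff_eq_left.2]
  rw [Set.disjoint_left]
  rintro _ ⟨q, -, rfl⟩ ⟨w, hw⟩
  cases hw

/-- The set of points at infinity that are represented in a set of nonzero vectors. -/
def classes (S : Set M.W) : Set M.Winf := {p | ∃ w, ∃ hw : w ≠ 0, w ∈ S ∧ M.toWinf w hw = p}

/-- `hrel` makes `S` saturated, so its preimage under the quotient map is again `S` without the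
origin. -/
lemma isOpen_classes {S : Set M.W} (hS : IsOpen S)
    (hrel : ∀ x w, x ≠ 0 → w ≠ 0 → M.Rel x w → x ∈ S → w ∈ S) : IsOpen (M.classes S) := by
  change IsOpen (Quotient.mk M.lineSetoid ⁻¹' M.classes S)
  convert hS.preimage continuous_subtype_val using 1
  ext ⟨w, hw⟩
  constructor
  · rintro ⟨x, hx, hxS, h⟩
    exact hrel x w hx hw (Quotient.exact h) hxS
  · exact fun h => ⟨w, hw, h, rfl⟩

lemma toWinf_eq {x w : M.W} (hx : x ≠ 0) (hw : w ≠ 0) (h : M.Rel x w) :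
    M.toWinf x hx = M.toWinf w hw := Quotient.sound h

lemma isOpen_classes_fst_ne_zero : IsOpen (M.classes {w | w.fst ≠ 0}) := by
  refine M.isOpen_classes ?_ ?_
  · exact isOpen_ne_fun (by fun_prop) continuous_const
  · rintro x w - - (⟨h, -, -⟩ | ⟨h, -, -⟩) hx
    · exact absurd h hx
    · exact h

end Topological

lemma inv_one_act (x : V) : M.act (M.inv M.one) x = x := by
  have := M.inv_act_act M.one_ne_zero x
  rwa [M.one_act] at this

/-- For `ξ ≠ 0` write `y ∈ Cu` as `ξ(ξ⁻¹y)`. Here `ξ⁻¹y ∈ Cu` by `C(Cu) = Cu`, and `ξ` multiplies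
inner products by `|ξ|²`. -/
lemma act_mem_orthogonal {u x : V} (ξ : C) (hx : x ∈ (M.orbit u)ᗮ) :
    M.act ξ x ∈ (M.orbit u)ᗮ := by
  by_cases hξ : ξ = 0
  · simp [hξ]
  rw [Submodule.mem_orthogonal] at hx ⊢
  intro y hy
  rw [← M.act_inv_act hξ y, M.inner_act_left, hx _ (M.act_mem_orbit _ hy), mul_zero]

/-- The volume condition constrains only sets inside a patch, so uniqueness requires locating the
points at infinity in patches. Here `[ζ, v] = [1, ζ⁻¹v]`. -/
lemma image_inf_subset_range_phiZero :
    (CPW.inf '' M.classes {w | w.fst ≠ 0} : Set M.CPW) ⊆ Set.range M.phiZero := by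
  rintro _ ⟨_, ⟨w, hw, hw1, rfl⟩, rfl⟩
  refine ⟨M.pt 0 (M.act (M.inv w.fst) w.snd), ?_⟩
  rw [phiZero, if_neg (by simp)]
  refine congrArg CPW.inf (M.toWinf_eq _ _ (Or.inr ⟨hw1, M.one_ne_zero, ?_⟩))
  exact M.inv_one_act _

variable [FiniteDimensional ℝ C] [FiniteDimensional ℝ V]

lemma coeff_eq_zero_iff {u x : V} : M.coeff u x = 0 ↔ x ∈ (M.orbit u)ᗮ := by
  rw [orbit, LinearMap.orthogonal_range]
  rfl

lemma coeff_add (u x y : V) : M.coeff u (x + y) = M.coeff u x + M.coeff u y :=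
  map_add (LinearMap.adjoint (M.act.flip u)) x y

lemma continuous_coeff (u : V) : Continuous (M.coeff u) :=
  LinearMap.continuous_of_finiteDimensional (LinearMap.adjoint (M.act.flip u))

lemma coeff_act_add {u x : V} (hu : ‖u‖ = 1) (η : C) (hx : x ∈ (M.orbit u)ᗮ) :
    M.coeff u (M.act η u + x) = η := by
  rw [coeff_add, M.coeff_act hu, M.coeff_eq_zero_iff.2 hx, add_zero]

lemma rest_act_add {u x : V} (hu : ‖u‖ = 1) (η : C) (hx : x ∈ (M.orbit u)ᗮ) :
    M.rest u (M.act η u + x) = x := by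
  rw [rest, M.coeff_act_add hu η hx, add_sub_cancel_left]

lemma act_coeff_add_rest (u x : V) : M.act (M.coeff u x) u + M.rest u x = x := by
  simp [rest]

lemma coeff_act_ne_zero {u x : V} {ξ : C} (hξ : ξ ≠ 0) (hx : M.coeff u x ≠ 0) :
    M.coeff u (M.act ξ x) ≠ 0 := by
  contrapose! hx
  rw [M.coeff_eq_zero_iff] at hx ⊢
  rw [← M.inv_act_act hξ x]
  exact M.act_mem_orthogonal _ hx

lemma isOpen_classes_coeff_ne_zero (u : V) : IsOpen (M.classes {w | M.coeff u w.snd ≠ 0}) := by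
  refine M.isOpen_classes ?_ ?_
  · exact isOpen_ne_fun ((M.continuous_coeff u).comp (by fun_prop)) continuous_const
  · rintro x w hx0 hw0 (⟨hx1, hw1, h⟩ | ⟨hw1, hx1, h⟩) hx
    · obtain ⟨ζ, hζ⟩ := M.mem_orbit.1 h
      change M.coeff u x.snd ≠ 0 at hx
      change M.coeff u w.snd ≠ 0
      contrapose! hx
      rw [M.coeff_eq_zero_iff] at hx ⊢
      rw [← hζ]
      exact M.act_mem_orthogonal _ hx
    · change M.coeff u w.snd ≠ 0
      rw [← M.act_inv_act hw1 w.snd, ← h]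
      exact M.coeff_act_ne_zero hw1 (M.coeff_act_ne_zero (M.inv_ne_zero hx1) hx)

lemma image_inf_subset_range_phiUnit (u : V) (hu : ‖u‖ = 1) :
    (CPW.inf '' M.classes {w | M.coeff u w.snd ≠ 0} : Set M.CPW) ⊆
      Set.range (M.phiUnit u hu) := by
  rintro _ ⟨_, ⟨w, hw, hw1, rfl⟩, rfl⟩
  change M.coeff u w.snd ≠ 0 at hw1
  have hphi : ∀ x ∈ (M.orbit u)ᗮ,
      M.coeff u x = 0 ∧ M.rest u x = x := fun x hx => by
    have h := M.coeff_eq_zero_iff.2 hx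
    exact ⟨h, by simp [rest, h]⟩
  by_cases h0 : w.fst = 0
  -- Multiplying by `η⁻¹` normalizes the `u`-component to `u`, giving `[0, u + x']` with `x' = η⁻¹
  -- w₂'`.
  · set η := M.coeff u w.snd
    have hx : M.act (M.inv η) (M.rest u w.snd) ∈ (M.orbit u)ᗮ :=
      M.act_mem_orthogonal _ (M.rest_mem_orthogonal hu _)
    refine ⟨M.pt 0 (M.act (M.inv η) (M.rest u w.snd)), ?_⟩
    obtain ⟨h1, h2⟩ := hphi _ hx
    refine (if_neg (not_not.2 h1)).trans ((if_neg (not_not.2 rfl)).trans ?_)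
    refine congrArg CPW.inf (M.toWinf_eq _ _ (Or.inl ⟨rfl, h0, M.mem_orbit.2 ⟨M.inv η, ?_⟩⟩))
    refine Eq.trans ?_ (congrArg (u + ·) h2.symm)
    conv_lhs => rw [← M.act_coeff_add_rest u w.snd, map_add, M.inv_act_act hw1]
  -- The class is `[1, y]` with `y = θu + y'`. Matching it with `[1, ζ⁻¹(u + x')]` forces `ζ = θ⁻¹`
  -- and `x' = θ⁻¹y'`.
  · set y := M.act (M.inv w.fst) w.snd with hy
    set θ := M.coeff u y
    have hθ : θ ≠ 0 := M.coeff_act_ne_zero (M.inv_ne_zero h0) hw1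
    have hx : M.act (M.inv θ) (M.rest u y) ∈ (M.orbit u)ᗮ :=
      M.act_mem_orthogonal _ (M.rest_mem_orthogonal hu _)
    refine ⟨M.pt (M.inv θ) (M.act (M.inv θ) (M.rest u y)), ?_⟩
    obtain ⟨h1, h2⟩ := hphi _ hx
    refine (if_neg (not_not.2 h1)).trans ((if_pos (M.inv_ne_zero hθ)).trans ?_)
    refine congrArg CPW.inf (M.toWinf_eq _ _ (Or.inr ⟨h0, M.one_ne_zero, ?_⟩))
    refine (M.inv_one_act _).trans
      ((congrArg (fun z => M.act (M.inv (M.inv θ)) (u + z)) h2).trans ?_)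
    rw [← hy, M.inv_inv hθ, map_add, M.act_inv_act hθ]
    exact M.act_coeff_add_rest u y

lemma exists_coeff_ne_zero {n : ℕ} {v : Fin n → V} (hv : M.IsOrthonormalCBasis v) {x : V}
    (hx : x ≠ 0) : ∃ j, M.coeff (v j) x ≠ 0 := by
  contrapose! hx
  have h : x ∈ (⨆ j, M.orbit (v j))ᗮ := by
    rw [← Submodule.iInf_orthogonal, Submodule.mem_iInf]
    exact fun j => M.coeff_eq_zero_iff.1 (hx j)
  rw [hv.iSup_eq_top, Submodule.top_orthogonal_eq_bot] at h
  exact h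

lemma range_inf_subset {n : ℕ} {v : Fin n → V} (hv : M.IsOrthonormalCBasis v) :
    (Set.range CPW.inf : Set M.CPW) ⊆ CPW.inf '' M.classes {w | w.fst ≠ 0} ∪
      ⋃ j, CPW.inf '' M.classes {w | M.coeff (v j) w.snd ≠ 0} := by
  rintro _ ⟨p, rfl⟩
  obtain ⟨⟨w, hw⟩, rfl⟩ := Quotient.exists_rep p
  by_cases h : w.fst = 0
  · have h2 : w.snd ≠ 0 := fun h' => hw (WithLp.ofLp_injective 2 (Prod.ext h h'))
    obtain ⟨j, hj⟩ := M.exists_coeff_ne_zero hv h2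
    exact Or.inr (Set.mem_iUnion.2 ⟨j, _, ⟨w, hw, hj, rfl⟩, rfl⟩)
  · exact Or.inl ⟨_, ⟨w, hw, h, rfl⟩, rfl⟩

omit [FiniteDimensional ℝ C] in
lemma finrank_eq {n : ℕ} {v : Fin n → V} (hv : M.IsOrthonormalCBasis v) :
    Module.finrank ℝ V = n * Module.finrank ℝ C := by
  have ho := OrthogonalFamily.of_pairwise (𝕜 := ℝ) hv.orthogonal
  have hi : DirectSum.IsInternal fun j => M.orbit (v j) := by
    rw [ho.isInternal_iff, hv.iSup_eq_top, Submodule.top_orthogonal_eq_bot]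
  rw [← (LinearEquiv.ofBijective (DirectSum.coeLinearMap fun j => M.orbit (v j)) hi).finrank_eq,
    Module.finrank_directSum]
  simp [M.finrank_orbit (hv.orthonormal.ne_zero _)]

end J2CModule
end

/-! ### Compatibility of the patches -/

noncomputable section

namespace J2CModule

variable {C V : Type*} [NormedAddCommGroup C] [InnerProductSpace ℝ C]
  [NormedAddCommGroup V] [InnerProductSpace ℝ V]
  [FiniteDimensional ℝ C] [FiniteDimensional ℝ V] [MeasurableSpace C] [BorelSpace C]
  [MeasurableSpace V] [BorelSpace V] (M : J2CModule C V)

/-- The measure on `W` whose density is the common density of all coordinate patches. -/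
def patchMeasure : Measure M.W := volume.withDensity (weight C M.W)

/-- A map to `CPW` which almost everywhere factors through the inclusion of `W`, by a map which
preserves `patchMeasure`. -/
def IsCompatible (κ : M.W → M.CPW) : Prop :=
  ∃ T : M.W → M.W, MeasurePreserving T M.patchMeasure M.patchMeasure ∧
    ∀ᵐ x : M.W, κ x = CPW.fin (T x)

lemma ae_patchMeasure {p : M.W → Prop} (h : ∀ᵐ x : M.W, p x) : ∀ᵐ x ∂M.patchMeasure, p x :=
  (withDensity_absolutelyContinuous _ _).ae_le h

lemma patchMeasure_apply (S : Set M.W) :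
    M.patchMeasure S = ∫⁻ x in S, ENNReal.ofReal (metricDensity M.metric x) := by
  rw [patchMeasure, withDensity_apply']
  simp only [metricDensity_metric]
  rfl

/-- This makes the masses prescribed by different patches agree: each is the mass of the part of `A`
in `W`. -/
lemma IsCompatible.preimage {κ : M.W → M.CPW} (h : M.IsCompatible κ) {A : Set M.CPW}
    (hA : MeasurableSet A) :
    M.patchMeasure (κ ⁻¹' A) = M.patchMeasure (CPW.fin ⁻¹' A) := by
  obtain ⟨T, hT, hκ⟩ := h
  rw [← hT.measure_preimage (M.continuous_fin.measurable hA).nullMeasurableSet]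
  refine measure_congr ((M.ae_patchMeasure hκ).mono fun x hx => ?_)
  change (κ x ∈ A) = (CPW.fin (T x) ∈ A)
  rw [hx]

lemma ae_fst_ne_zero (E : Type*) [NormedAddCommGroup E]
    [InnerProductSpace ℝ E] [FiniteDimensional ℝ E] [MeasurableSpace E] [BorelSpace E]
    [Nontrivial C] : ∀ᵐ p : WithLp 2 (C × E), p.fst ≠ 0 := by
  have hne : ∀ᵐ η : C, η ≠ 0 := by
    rw [ae_iff]
    simp
  exact (WithLp.volume_preserving_ofLp C E).quasiMeasurePreserving.ae
    (Measure.quasiMeasurePreserving_fst.ae hne)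

/-- The isometry `g` singles out the coordinate to be inverted. It carries the weight along because
the weight depends only on norm and dimension, and the excluded set `p.fst = 0` is null. -/
lemma isCompatible_of_transition {E : Type*} [NormedAddCommGroup E]
    [InnerProductSpace ℝ E] [FiniteDimensional ℝ E] [MeasurableSpace E] [BorelSpace E]
    (L : C → E →ₗ[ℝ] E) (hLc : Continuous fun p : C × E => L p.1 p.2)
    (hL : ∀ ξ x, ‖L ξ x‖ = ‖ξ‖ * ‖x‖) (g : WithLp 2 (C × E) ≃ₗᵢ[ℝ] M.W) {κ : M.W → M.CPW}
    (hκ : ∀ p : WithLp 2 (C × E), p.fst ≠ 0 →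
      κ (g p) = CPW.fin (g (WithLp.toLp 2 (M.inv p.fst, L (M.inv p.fst) p.snd)))) :
    M.IsCompatible κ := by
  have := M.nontrivial
  let S : WithLp 2 (C × E) → WithLp 2 (C × E) := fun p =>
    WithLp.toLp 2 (M.inv p.fst, L (M.inv p.fst) p.snd)
  have hS : Measurable S := by
    have h1 : Measurable fun p : C × E => L (M.inv p.1) p.2 :=
      hLc.measurable.comp ((M.measurable_inv.comp measurable_fst).prodMk measurable_snd)
    exact (WithLp.volume_preserving_toLp C E).measurable.comp
      (((M.measurable_inv.comp measurable_fst).prodMk h1).comp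
        (WithLp.volume_preserving_ofLp C E).measurable)
  have hg : Measurable g := g.continuous.measurable
  have hgs : Measurable g.symm := g.symm.continuous.measurable
  have hw : ∀ p, weight C M.W (g p) = weight C (WithLp 2 (C × E)) p := fun p => by
    rw [weight, weight, g.norm_map, g.toLinearEquiv.finrank_eq]
  have hT : Measurable fun x => g (S (g.symm x)) := hg.comp (hS.comp hgs)
  refine ⟨fun x => g (S (g.symm x)), ⟨hT, ?_⟩, ?_⟩
  · ext B hB
    have key : ∀ Q : Set M.W, MeasurableSet Q → M.patchMeasure Q =
        ∫⁻ p : WithLp 2 (C × E), (g ⁻¹' Q).indicator 1 p * weight C (WithLp 2 (C × E)) p := by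
      intro Q hQ
      have hm : Measurable fun x : M.W => Q.indicator 1 x * weight C M.W x :=
        (measurable_one.indicator hQ).mul measurable_weight
      rw [patchMeasure, withDensity_apply _ hQ, ← lintegral_indicator hQ]
      have : ∀ x, Q.indicator (weight C M.W) x = Q.indicator 1 x * weight C M.W x := fun x => by
        by_cases hx : x ∈ Q <;> simp [hx]
      simp only [this]
      rw [← g.measurePreserving.lintegral_comp hm]
      simp only [hw]
      rfl
    rw [Measure.map_apply hT hB, key _ (hT hB), key _ hB,
      ← M.lintegral_comp_transition L hLc hL (measurable_one.indicator (hg hB))]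
    refine lintegral_congr fun p => ?_
    congr 1
    have hp : g (S (g.symm (g p))) = g (S p) := by rw [g.symm_apply_apply]
    change B.indicator (1 : M.W → ENNReal) (g (S (g.symm (g p)))) = B.indicator 1 (g (S p))
    rw [hp]
  · have h := (g.symm.measurePreserving.quasiMeasurePreserving).ae (ae_fst_ne_zero (C := C) E)
    refine h.mono fun x hx => ?_
    have := hκ (g.symm x) hx
    rwa [g.apply_symm_apply] at this

lemma isCompatible_fin : M.IsCompatible CPW.fin :=
  ⟨id, MeasurePreserving.id _, Filter.Eventually.of_forall fun _ => rfl⟩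

omit [MeasurableSpace C] [BorelSpace C] [MeasurableSpace V] [BorelSpace V] in
lemma continuous_act : Continuous fun p : C × V => M.act p.1 p.2 :=
  (LinearMap.toContinuousBilinearMap M.act).continuous₂

lemma isCompatible_phiZero : M.IsCompatible M.phiZero :=
  M.isCompatible_of_transition (fun ξ => M.act ξ) M.continuous_act M.norm_act
    (LinearIsometryEquiv.refl ℝ M.W) fun _ hp => if_pos hp

/-- The product of `C` on `Cu` combined with the action of `C` on `(Cu)ᗮ`. -/
def restAct (u : V) (ξ : C) :
    WithLp 2 (C × (M.orbit u)ᗮ) →ₗ[ℝ] WithLp 2 (C × (M.orbit u)ᗮ) :=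
  (WithLp.linearEquiv 2 ℝ _).symm.toLinearMap ∘ₗ
    LinearMap.prodMap (LinearMap.adjoint (M.act.flip u) ∘ₗ M.act ξ ∘ₗ M.act.flip u)
      ((M.act ξ).restrict fun _ hx => M.act_mem_orthogonal ξ hx) ∘ₗ
    (WithLp.linearEquiv 2 ℝ _).toLinearMap

omit [MeasurableSpace C] [BorelSpace C] [MeasurableSpace V] [BorelSpace V] in
lemma restAct_apply (u : V) (ξ : C) (e : WithLp 2 (C × (M.orbit u)ᗮ)) :
    M.restAct u ξ e = WithLp.toLp 2 (M.mulAt u ξ e.fst,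
      ⟨M.act ξ e.snd, M.act_mem_orthogonal ξ e.snd.2⟩) := rfl

omit [MeasurableSpace C] [BorelSpace C] [MeasurableSpace V] [BorelSpace V] in
lemma norm_restAct {u : V} (hu : ‖u‖ = 1) (ξ : C) (e : WithLp 2 (C × (M.orbit u)ᗮ)) :
    ‖M.restAct u ξ e‖ = ‖ξ‖ * ‖e‖ := by
  rw [← sq_eq_sq₀ (norm_nonneg _) (by positivity), mul_pow, restAct_apply,
    WithLp.prod_norm_sq_eq_of_L2, WithLp.prod_norm_sq_eq_of_L2]
  have h1 : ‖M.mulAt u ξ e.fst‖ = ‖ξ‖ * ‖e.fst‖ := by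
    have := congrArg norm (M.mulAt_act hu ξ e.fst)
    simpa [M.norm_act, hu] using this
  simp only [WithLp.toLp_fst, WithLp.toLp_snd, h1, Submodule.coe_norm, M.norm_act]
  ring

omit [MeasurableSpace C] [BorelSpace C] [MeasurableSpace V] [BorelSpace V] in
lemma continuous_restAct (u : V) :
    Continuous fun p : C × WithLp 2 (C × (M.orbit u)ᗮ) => M.restAct u p.1 p.2 := by
  simp only [restAct_apply]
  have ha := M.continuous_act
  refine (WithLp.prod_continuous_toLp 2 _ _).comp (Continuous.prodMk ?_ ?_)
  · refine (M.continuous_coeff u).comp (ha.comp (continuous_fst.prodMk ?_))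
    exact ha.comp (Continuous.prodMk (by fun_prop) continuous_const)
  · exact Continuous.subtype_mk (ha.comp (continuous_fst.prodMk (by fun_prop))) _

/-- The isometry `(η, (ζ, x')) ↦ (ζ, η u + x')`. -/
def splitting (u : V) (hu : ‖u‖ = 1) :
    WithLp 2 (C × WithLp 2 (C × (M.orbit u)ᗮ)) ≃ₗᵢ[ℝ] M.W :=
  LinearIsometryEquiv.ofSurjective
    { toFun := fun p => M.pt p.snd.fst (M.act p.fst u + p.snd.snd)
      map_add' := fun p q => by
        refine WithLp.ofLp_injective 2 (Prod.ext rfl ?_)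
        simp only [WithLp.add_fst, WithLp.add_snd, map_add, LinearMap.add_apply,
          Submodule.coe_add, WithLp.ofLp_add, Prod.snd_add]
        abel
      map_smul' := fun c p => by
        refine WithLp.ofLp_injective 2 (Prod.ext rfl ?_)
        simp
      norm_map' := fun p => by
        rw [← sq_eq_sq₀ (norm_nonneg _) (norm_nonneg _), WithLp.prod_norm_sq_eq_of_L2 p,
          WithLp.prod_norm_sq_eq_of_L2 p.snd]
        have h : inner ℝ (M.act p.fst u) (p.snd.snd : V) = 0 :=
          (Submodule.mem_orthogonal _ _).1 p.snd.snd.2 _ (M.mem_orbit.2 ⟨_, rfl⟩)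
        refine (WithLp.prod_norm_sq_eq_of_L2 _).trans ?_
        change ‖p.snd.fst‖ ^ 2 + ‖M.act p.fst u + p.snd.snd‖ ^ 2 = _
        rw [norm_add_sq_real, h, M.norm_act, hu, Submodule.coe_norm]
        ring }
    fun w => ⟨WithLp.toLp 2 (M.coeff u w.snd,
      WithLp.toLp 2 (w.fst, ⟨M.rest u w.snd, M.rest_mem_orthogonal hu _⟩)),
      WithLp.ofLp_injective 2 (Prod.ext rfl (M.act_coeff_add_rest u w.snd))⟩

omit [MeasurableSpace C] [BorelSpace C] [MeasurableSpace V] [BorelSpace V] in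
lemma splitting_apply (u : V) (hu : ‖u‖ = 1) (p : WithLp 2 (C × WithLp 2 (C × (M.orbit u)ᗮ))) :
    M.splitting u hu p = M.pt p.snd.fst (M.act p.fst u + p.snd.snd) := rfl

/-- After `splitting`, the finite branch is `(η, (ζ, x')) ↦ (η⁻¹, (η⁻¹ ·ᵤ ζ, η⁻¹x'))`: the same form
as `φ₀`, with `E = C ⊕ (Cu)ᗮ`. -/
lemma isCompatible_phiUnit (u : V) (hu : ‖u‖ = 1) : M.IsCompatible (M.phiUnit u hu) := by
  refine M.isCompatible_of_transition (M.restAct u) (M.continuous_restAct u) (M.norm_restAct hu)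
    (M.splitting u hu) fun p hp => ?_
  have h1 := M.coeff_act_add hu p.fst p.snd.snd.2
  have h2 := M.rest_act_add hu p.fst p.snd.snd.2
  simp only [phiUnit, splitting_apply, WithLp.toLp_snd, WithLp.toLp_fst, h1, h2, restAct_apply]
  exact if_pos (h1.symm ▸ hp)

lemma isCompatible_chart {n : ℕ} {v : Fin n → V} (hv : M.IsOrthonormalCBasis v)
    (i : ChartIndex n) : M.IsCompatible (M.chart hv i) := by
  cases i with
  | zero => exact M.isCompatible_phiZero
  | basis j => exact M.isCompatible_phiUnit _ (hv.orthonormal.1 j)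
  | last => exact M.isCompatible_fin

/-! ### Existence, uniqueness and total mass -/

lemma isVolume_map_patchMeasure {n : ℕ} {v : Fin n → V} (hv : M.IsOrthonormalCBasis v) :
    M.IsVolume hv (M.patchMeasure.map CPW.fin) := by
  intro i A hA _
  rw [Measure.map_apply M.continuous_fin.measurable hA, ← patchMeasure_apply,
    (M.isCompatible_chart hv i).preimage M hA]

lemma IsVolume.eq_map {n : ℕ} {v : Fin n → V} {hv : M.IsOrthonormalCBasis v}
    {μ : Measure M.CPW} (h : M.IsVolume hv μ) : μ = M.patchMeasure.map CPW.fin := by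
  -- Inside a patch, the mass of a set at infinity equals that of its preimage under the inclusion
  -- of `W`, which is empty.
  have hnull : ∀ (i : ChartIndex n) (N : Set M.Winf), IsOpen N →
      (CPW.inf '' N : Set M.CPW) ⊆ Set.range (M.chart hv i) →
      μ (CPW.inf '' N : Set M.CPW) = 0 := by
    intro i N hN hi
    have hm := M.measurableSet_image_inf hN
    rw [h i _ hm hi, ← patchMeasure_apply, (M.isCompatible_chart hv i).preimage M hm]
    convert measure_empty (μ := M.patchMeasure)
    refine Set.eq_empty_of_forall_notMem ?_
    rintro x ⟨p, -, hp⟩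
    cases hp
  have hinf : μ (Set.range CPW.inf) = 0 := by
    refine measure_mono_null (M.range_inf_subset hv) (measure_union_null ?_
      (measure_iUnion_null fun j => ?_))
    · exact hnull .zero _ M.isOpen_classes_fst_ne_zero M.image_inf_subset_range_phiZero
    · exact hnull (.basis j) _ (M.isOpen_classes_coeff_ne_zero _)
        (M.image_inf_subset_range_phiUnit _ (hv.orthonormal.1 j))
  ext A hA
  have hR : MeasurableSet (Set.range (CPW.fin : M.W → M.CPW)) := M.isOpen_range_fin.measurableSet
  have h0 : μ (A \ Set.range CPW.fin) = 0 := by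
    refine measure_mono_null ?_ hinf
    rintro (w | p) ⟨-, hx⟩
    · exact absurd ⟨w, rfl⟩ hx
    · exact ⟨p, rfl⟩
  rw [← measure_inter_add_sdiff A hR, h0, add_zero,
    h .last _ (hA.inter hR) Set.inter_subset_right, ← patchMeasure_apply,
    Measure.map_apply M.continuous_fin.measurable hA]
  congr 1
  ext x
  simp [chart]

lemma patchMeasure_univ {n : ℕ} {v : Fin n → V} (hv : M.IsOrthonormalCBasis v) :
    M.patchMeasure Set.univ = ENNReal.ofReal (Real.Gamma ((Module.finrank ℝ C : ℝ) / 2) /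
      Real.Gamma (((n + 1 : ℕ) + 1 : ℝ) * ((Module.finrank ℝ C : ℝ) / 2)) *
      Real.pi ^ (((n + 1 : ℕ) : ℝ) * ((Module.finrank ℝ C : ℝ) / 2))) := by
  have := M.nontrivial
  have hd : (0 : ℝ) < Module.finrank ℝ C := Nat.cast_pos.2 Module.finrank_pos
  have hW : (Module.finrank ℝ M.W : ℝ) = ((n + 1 : ℕ) : ℝ) * Module.finrank ℝ C := by
    rw [(WithLp.linearEquiv 2 ℝ (C × V)).finrank_eq, Module.finrank_prod, M.finrank_eq hv]
    push_cast
    ring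
  rw [patchMeasure, withDensity_apply _ MeasurableSet.univ, setLIntegral_univ]
  unfold weight
  -- Here `s = (d + dim W)/2`, so `s - dim W/2 = d/2`, which is positive since `C` contains `1 ≠ 0`;
  -- and `dim W = (n + 1)d` gives `s = (n + 2)d/2`.
  rw [lintegral_one_add_norm_sq_rpow_neg M.W (by linarith), hW]
  congr 4
  · ring
  · ring
  · ring

end J2CModule

end

theorem theorem7p1 {C V : Type*} [NormedAddCommGroup C] [InnerProductSpace ℝ C]
    [FiniteDimensional ℝ C] [MeasurableSpace C] [BorelSpace C]
    [NormedAddCommGroup V] [InnerProductSpace ℝ V]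
    [FiniteDimensional ℝ V] [MeasurableSpace V] [BorelSpace V]
    (M : J2CModule C V) {n : ℕ} {v : Fin n → V} (hv : M.IsOrthonormalCBasis v)
    (d m : ℕ) (hd : d = Module.finrank ℝ C) (hm : m = n + 1) :
    (∃! μ : MeasureTheory.Measure M.CPW, M.IsVolume hv μ) ∧
    ∀ μ : MeasureTheory.Measure M.CPW, M.IsVolume hv μ →
      μ Set.univ = ENNReal.ofReal (Real.Gamma ((d : ℝ) / 2) /
        Real.Gamma (((m : ℝ) + 1) * ((d : ℝ) / 2)) * Real.pi ^ ((m : ℝ) * ((d : ℝ) / 2))) := by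
  subst hd hm
  refine ⟨⟨_, M.isVolume_map_patchMeasure hv, fun μ hμ => hμ.eq_map M⟩, fun μ hμ => ?_⟩
  rw [hμ.eq_map M, MeasureTheory.Measure.map_apply M.continuous_fin.measurable MeasurableSet.univ,
    Set.preimage_univ, M.patchMeasure_univ hv]
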